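/- Let $m,n,r$ be positive integers with $n\ge 4.847323\,m$, let $V$ be a set with $n$ elements, and let $Y\subseteq V$ have $m$ elements. For a finite set $X$ let $\binom{X}{4}$ denote the set of all 4-element subsets of $X$ (the edges of the complete 4-uniform hypergraph on $X$). A partial $r$-factorization of $K_m^4=(Y,\binom{Y}{4})$ is a coloring of $\binom{Y}{4}$ with at most $\binom{n-1}{3}/r$ colors (color classes may be empty) such that every element of $V$ lies in at most $r$ sets of each color. An $r$-factorization of $K_n^4=(V,\binom{V}{4})$ is a coloring of $\binom{V}{4}$ such that every element of $V$ lies in exactly $r$ sets of each color. It extends a coloring of $\binom{Y}{4}$ if the two colorings agree on $\binom{Y}{4}$. Then any given partial $r$-factorization of $K_m^4$ can be extended to an $r$-factorization of $K_n^4$ if and only if $4\mid rn$ and $r\mid\binom{n-1}{3}$. -/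

import Mathlib

/-- The set of all `h`-subsets of the finite set `Y`, that is, the edge set of the complete
`h`-uniform hypergraph on the vertex set `Y`. -/
def completeEdges {V : Type*} (h : ℕ) (Y : Finset V) : Finset (Finset V) :=
  Finset.powersetCard h Y

/-- A coloring of the edges in `S` with the `k` colors `0, …, k - 1`; color classes may be empty. -/
abbrev EdgeColoring {V : Type*} (S : Finset (Finset V)) (k : ℕ) : Type _ :=
  {e : Finset V // e ∈ S} → Fin k

namespace EdgeColoring

variable {V : Type*} [Fintype V] [DecidableEq V]

/-- The degree of the vertex `v` in the color class `i`: the number of edges of color `i`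
that contain `v`. -/
def degree {S : Finset (Finset V)} {k : ℕ} (f : EdgeColoring S k) (i : Fin k) (v : V) : ℕ :=
  (Finset.univ.filter fun e : {e : Finset V // e ∈ S} => f e = i ∧ v ∈ e.1).card

/-- `f` is a partial `r`-factorization of the set `S` of `h`-subsets of the `n`-set `V`:
it uses at most `(n-1).choose (h-1) / r` colors (written without division), and every vertex
has degree at most `r` in every color class. -/
structure IsPartialFactorization (h r : ℕ) {S : Finset (Finset V)} {k : ℕ}
    (f : EdgeColoring S k) : Prop where
  subset : S ⊆ completeEdges h Finset.univ
  colors_le : k * r ≤ (Fintype.card V - 1).choose (h - 1)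
  degree_le : ∀ (i : Fin k) (v : V), f.degree i v ≤ r

/-- `g` is an `r`-factorization of the complete `h`-uniform hypergraph on `V`: every vertex has
degree exactly `r` in every color class. -/
def IsFactorization (h r : ℕ) {l : ℕ}
    (g : EdgeColoring (completeEdges h (Finset.univ : Finset V)) l) : Prop :=
  ∀ (i : Fin l) (v : V), g.degree i v = r

/-- `g` extends `f`: every edge colored by `f` is colored by `g`, with the same color. -/
def Extends {S T : Finset (Finset V)} {k l : ℕ} (g : EdgeColoring T l) (f : EdgeColoring S k) :
    Prop :=
  ∀ e : {e : Finset V // e ∈ S}, ∃ hT : e.1 ∈ T, (g ⟨e.1, hT⟩ : ℕ) = (f e : ℕ)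

end EdgeColoring

/-!
Necessity is double counting: in an `r`-factorization with `l` colors the edges at a vertex give
`l * r = (n - 1).choose 3`, and the degrees in one color class give `4 ∣ r * n`.

For sufficiency let `l = (n - 1).choose 3 / r`. Identify all vertices outside `Y`, so that only the
trace `e ∩ Y` of an edge `e` matters. It is enough to color the edges so that `f` is extended, every
vertex of `Y` has degree `r` in every color, and every color class has `r * n / 4` edges
(`exists_isFactorization_of_regular_on`). Indeed the vertices outside `Y` can then be separated one
at a time (`exists_detachment`), in the manner of Brouwer and Schrijver's proof of Baranyai's
theorem: each new vertex takes an equal fractional share of the unspecified places in the edges,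
and this fractional choice is rounded to an integral one (`exists_finset_card_fiber_eq`), which is
the integrality of transportation problems and follows from Hall's theorem.

To find that coloring, first treat the edges with three vertices in `Y` and then those with two,
greedily, keeping all color degrees at most `r` (`exists_greedy_coloring_two_le`). An edge `{a, b}`
plus two vertices outside `Y` is blocked only if every color is full at `a` or at `b`, hence only if
the colored edges at `a` and at `b` together number at least `(n - 1).choose 3`; as each of them
has fewer than `(n - 1).choose 3 - (n - m).choose 3` (the edge `{a, b}` itself being uncolored), this
is impossible if `(n - 1).choose 3 ≤ 2 * (n - m).choose 3`, which is what `n ≥ 4.847323 m` provides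
(`choose_three_le_two_mul_choose_three`). The edges with one vertex `v` in `Y` are exactly
as many as the degrees still missing at `v`. After that a color class has at most `r * m` edges that
meet `Y`, which is at most `r * n / 4`, so the edges outside `Y` can fill it up
(`exists_regular_coloring`).
-/

open Finset

/-! ### Rounding a fractional selection -/

theorem sum_le_sum_image_fiber {ε τ : Type*} [Fintype ε] [DecidableEq τ] (S : Finset ε)
    (p : ε → τ) {u : ε → ℝ} (hu : ∀ e, 0 ≤ u e) :
    ∑ e ∈ S, u e ≤ ∑ j ∈ S.image p, ∑ e with p e = j, u e := by
  rw [← sum_fiberwise_of_maps_to (s := S) (t := S.image p) (g := p)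
    (fun e he => mem_image_of_mem p he)]
  refine sum_le_sum fun j _ => sum_le_sum_of_subset_of_nonneg ?_ fun e _ _ => hu e
  exact filter_subset_filter _ (subset_univ S)

/-- Integrality of transportation problems: if weights in `[0, 1]` have integral sums over all rows
and all columns, then some set has these sums as its numbers of elements in the rows and columns.
The elements are matched, by Hall's theorem, to places in their columns (the selected elements) or
in their rows (the others); the weights certify Hall's condition. -/
theorem exists_finset_card_fiber_eq {ε ι κ : Type*} [Fintype ε] [DecidableEq ε]
    [Fintype ι] [DecidableEq ι] [Fintype κ] [DecidableEq κ] (row : ε → ι) (col : ε → κ)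
    (a : ι → ℕ) (b : κ → ℕ) (w : ε → ℝ) (hw0 : ∀ e, 0 ≤ w e) (hw1 : ∀ e, w e ≤ 1)
    (ha : ∀ i, ∑ e with row e = i, w e = a i) (hb : ∀ j, ∑ e with col e = j, w e = b j) :
    ∃ D : Finset ε, (∀ i, #{e ∈ D | row e = i} = a i) ∧ ∀ j, #{e ∈ D | col e = j} = b j := by
  classical
  have haC (i : ι) : a i ≤ #{e | row e = i} := by
    have : (a i : ℝ) ≤ #{e | row e = i} := by
      rw [← ha, card_eq_sum_ones, Nat.cast_sum]
      exact sum_le_sum fun e _ => by simpa using hw1 e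
    exact_mod_cast this
  let A : ι → ℕ := fun i => #{e | row e = i} - a i
  have hA (i : ι) : ∑ e with row e = i, (1 - w e) = A i := by
    simp only [A]
    rw [Nat.cast_sub (haC i), sum_sub_distrib, ha]
    simp
  -- A slot is either one of the `b j` places in column `j`, or one of the `A i` places
  -- for unselected elements of row `i`.
  let R : ε → ((Σ j, Fin (b j)) ⊕ (Σ i, Fin (A i))) → Prop := fun e =>
    Sum.elim (fun s => col e = s.1) (fun s => row e = s.1)
  have hall : ∀ S : Finset ε, #S ≤ #{s | ∃ e ∈ S, R e s} := by
    intro S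
    have hcard : #{s | ∃ e ∈ S, R e s} = ∑ j ∈ S.image col, b j + ∑ i ∈ S.image row, A i := by
      rw [card_filter, Fintype.sum_sum_type, Fintype.sum_sigma, Fintype.sum_sigma]
      simp only [R, Sum.elim_inl, Sum.elim_inr, sum_const, card_univ, Fintype.card_fin,
        smul_eq_mul, mul_ite, mul_one, mul_zero, ← mem_image]
      rw [← sum_filter, ← sum_filter]
      congr 1 <;> exact sum_congr (by ext; simp) fun _ _ => rfl
    have h1 := sum_le_sum_image_fiber S col hw0
    have h2 := sum_le_sum_image_fiber S row fun e => sub_nonneg.2 (hw1 e)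
    simp only [hb] at h1
    simp only [hA] at h2
    rw [sum_sub_distrib] at h2
    rw [hcard]
    have : (#S : ℝ) ≤ ((∑ j ∈ S.image col, b j + ∑ i ∈ S.image row, A i : ℕ) : ℝ) := by
      push_cast
      simp only [sum_const, nsmul_eq_mul, mul_one] at h2
      linarith
    exact_mod_cast this
  obtain ⟨φ, hφ, hR⟩ := (Fintype.all_card_le_filter_rel_iff_exists_injective R).1 hall
  let D : Finset ε := {e | (φ e).isLeft}
  have hDcol (j : κ) : #{e ∈ D | col e = j} ≤ b j := by
    have : #{e ∈ D | col e = j} ≤ #((univ : Finset (Fin (b j))).image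
        fun u => (Sum.inl ⟨j, u⟩ : (Σ j, Fin (b j)) ⊕ (Σ i, Fin (A i)))) := by
      refine card_le_card_of_injOn φ ?_ hφ.injOn
      intro e he
      simp only [D, coe_filter, mem_filter, mem_univ, true_and, Set.mem_ofPred_eq] at he
      have h := hR e
      obtain ⟨⟨j', u⟩, hs⟩ := Sum.isLeft_iff.1 he.1
      simp only [hs, R, Sum.elim_inl] at h
      obtain rfl : j' = j := h.symm.trans he.2
      simp [hs]
    exact this.trans (card_image_le.trans (by simp))
  have hDrow (i : ι) : #{e ∈ Dᶜ | row e = i} ≤ A i := by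
    have : #{e ∈ Dᶜ | row e = i} ≤ #((univ : Finset (Fin (A i))).image
        fun u => (Sum.inr ⟨i, u⟩ : (Σ j, Fin (b j)) ⊕ (Σ i, Fin (A i)))) := by
      refine card_le_card_of_injOn φ ?_ hφ.injOn
      intro e he
      simp only [D, coe_filter, mem_compl, mem_filter, mem_univ, true_and, Set.mem_ofPred_eq,
        Bool.not_eq_true, Sum.isLeft_eq_false] at he
      have h := hR e
      obtain ⟨⟨j', u⟩, hs⟩ := Sum.isRight_iff.1 he.1
      simp only [hs, R, Sum.elim_inr] at h
      obtain rfl : j' = i := h.symm.trans he.2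
      simp [hs]
    exact this.trans (card_image_le.trans (by simp))
  have hrow (i : ι) : a i ≤ #{e ∈ D | row e = i} := by
    have h := hDrow i
    have hsplit : #{e | row e = i} = #{e ∈ D | row e = i} + #{e ∈ Dᶜ | row e = i} := by
      rw [← card_union_of_disjoint (disjoint_filter_filter disjoint_compl_right), ← filter_union,
        union_compl]
    have := haC i
    simp only [A] at h
    omega
  -- Both families of upper bounds are attained, because they have the same total.
  have htot : ∑ i, a i = ∑ j, b j := by
    have h1 := sum_fiberwise (univ : Finset ε) row w
    have h2 := sum_fiberwise (univ : Finset ε) col w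
    simp only [ha] at h1
    simp only [hb] at h2
    exact_mod_cast h1.trans h2.symm
  have hD1 : ∑ i, #{e ∈ D | row e = i} = #D :=
    (card_eq_sum_card_fiberwise fun _ _ => mem_coe.2 (mem_univ _)).symm
  have hD2 : ∑ j, #{e ∈ D | col e = j} = #D :=
    (card_eq_sum_card_fiberwise fun _ _ => mem_coe.2 (mem_univ _)).symm
  have hle1 := sum_le_sum fun i (_ : i ∈ univ) => hrow i
  have hle2 := sum_le_sum fun j (_ : j ∈ univ) => hDcol j
  refine ⟨D, fun i => ?_, fun j => ?_⟩
  · exact ((sum_eq_sum_iff_of_le fun i _ => hrow i).1 (by omega) i (mem_univ i)).symm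
  · exact (sum_eq_sum_iff_of_le fun j _ => hDcol j).1 (by omega) j (mem_univ j)

/-! ### Detaching the vertices outside `Y` -/

/-- One detachment step. The set `tr e ⊆ W` is the part of the edge `e` that is already known; the
other `h - #(tr e)` vertices of `e` are unspecified vertices outside `W`. The edges in `D` are those
that receive the new vertex `v`. The fractional solution gives `v` an equal share of all unspecified
places: an edge `e` gets the weight `(h - #(tr e)) / (card V - #W)`. -/
theorem exists_detachment_step {V ε : Type*} [Fintype V] [DecidableEq V] [Fintype ε]
    [DecidableEq ε] {h l r q : ℕ} (hq : h * q = r * Fintype.card V) (c : ε → Fin l)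
    (hc : ∀ i, #{e | c e = i} = q) {W : Finset V} {v : V} (hv : v ∉ W) (tr : ε → Finset V)
    (hsub : ∀ e, tr e ⊆ W) (hle : ∀ e, #(tr e) ≤ h)
    (hfib : ∀ X ⊆ W, #X ≤ h → #{e | tr e = X} = (Fintype.card V - #W).choose (h - #X))
    (hdeg : ∀ i, ∀ x ∈ W, #{e | c e = i ∧ x ∈ tr e} = r) :
    ∃ D : Finset ε, (∀ i, #{e ∈ D | c e = i} = r) ∧
      (∀ X ⊆ W, #X < h → #{e ∈ D | tr e = X} =
        (Fintype.card V - #W - 1).choose (h - #X - 1)) ∧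
      ∀ e ∈ D, #(tr e) < h := by
  have hWn : #W < Fintype.card V := card_lt_univ_of_notMem hv
  obtain ⟨N, hN⟩ : ∃ N, Fintype.card V - #W = N + 1 := ⟨_, (Nat.sub_add_cancel (by omega)).symm⟩
  have hN0 : (0 : ℝ) < (N : ℝ) + 1 := by positivity
  -- An edge cannot have more unspecified places than there are vertices outside `W`.
  have hch (e : ε) : h - #(tr e) ≤ N + 1 := by
    by_contra hcon
    have h1 := hfib (tr e) (hsub e) (hle e)
    rw [hN, Nat.choose_eq_zero_of_lt (by omega), card_eq_zero] at h1
    exact notMem_empty e (h1 ▸ mem_filter.2 ⟨mem_univ e, rfl⟩)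
  let b : Finset V → ℕ := fun X => if X ⊆ W ∧ #X < h then N.choose (h - #X - 1) else 0
  obtain ⟨D, hD1, hD2⟩ := exists_finset_card_fiber_eq c tr (fun _ => r) b
    (fun e => ((h - #(tr e) : ℕ) : ℝ) / (N + 1)) (fun e => by positivity)
    (fun e => by
      rw [div_le_one hN0]
      exact_mod_cast hch e)
    (fun i => by
      rw [← sum_div, div_eq_iff hN0.ne']
      have h1 : ∑ e with c e = i, (h - #(tr e)) + ∑ e with c e = i, #(tr e) = h * q := by
        rw [← sum_add_distrib, sum_congr rfl fun e _ => Nat.sub_add_cancel (hle e)]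
        simp [hc, mul_comm]
      have h2 : ∑ e with c e = i, #(tr e) = #W * r := by
        have h3 := sum_card_bipartiteAbove_eq_sum_card_bipartiteBelow
          (s := ({e | c e = i} : Finset ε)) (t := W) (fun e x => x ∈ tr e)
        have h4 (e : ε) : bipartiteAbove (fun e x => x ∈ tr e) W e = tr e := by
          ext x
          simpa [bipartiteAbove] using fun hx => hsub e hx
        simp only [h4] at h3
        rw [h3, ← smul_eq_mul, ← sum_const]
        refine sum_congr rfl fun x hx => ?_
        rw [← hdeg i x hx, bipartiteBelow, filter_filter]
      have h5 : ∑ e with c e = i, (h - #(tr e)) = r * (N + 1) := by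
        rw [h2, hq] at h1
        rw [show Fintype.card V = #W + (N + 1) by omega] at h1
        linarith
      exact_mod_cast h5)
    (fun X => by
      rw [← sum_div, div_eq_iff hN0.ne', sum_congr rfl (g := fun _ => ((h - #X : ℕ) : ℝ))
        fun e he => by rw [(mem_filter.1 he).2], sum_const, nsmul_eq_mul]
      by_cases hX : X ⊆ W ∧ #X < h
      · simp only [b, if_pos hX]
        rw [hfib X hX.1 hX.2.le, hN]
        obtain ⟨j, hj⟩ : ∃ j, h - #X = j + 1 := ⟨_, (Nat.sub_add_cancel (by omega)).symm⟩
        rw [hj, Nat.add_sub_cancel, mul_comm (N.choose j : ℝ)]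
        exact_mod_cast (Nat.add_one_mul_choose_eq N j).symm
      · simp only [b, if_neg hX, Nat.cast_zero, zero_mul, mul_eq_zero, Nat.cast_eq_zero]
        by_cases hXW : X ⊆ W
        · exact Or.inr (by simp only [hXW, true_and] at hX; omega)
        · refine Or.inl (card_eq_zero.2 (filter_eq_empty_iff.2 ?_))
          rintro e - rfl
          exact hXW (hsub e))
  refine ⟨D, hD1, fun X hX hXh => ?_, fun e he => ?_⟩
  · rw [hD2, hN]
    simp [b, hX, hXh]
  · by_contra hcon
    have h1 := hD2 (tr e)
    simp only [b, hcon, and_false, if_false, card_eq_zero] at h1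
    exact notMem_empty e (h1 ▸ mem_filter.2 ⟨he, rfl⟩)

/-- Iterated detachment: if a coloring looks like an `r`-factorization of the complete `h`-uniform
hypergraph when all vertices outside `Y` are identified, then the vertices of `U` can be
distinguished as well, without changing the traces of the edges on `Y`. -/
theorem exists_detachment {V ε : Type*} [Fintype V] [DecidableEq V] [Fintype ε]
    [DecidableEq ε] {h l r q : ℕ} (hq : h * q = r * Fintype.card V) (c : ε → Fin l)
    (hc : ∀ i, #{e | c e = i} = q) {Y : Finset V} (tr₀ : ε → Finset V)
    (hsub : ∀ e, tr₀ e ⊆ Y) (hle : ∀ e, #(tr₀ e) ≤ h)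
    (hfib : ∀ X ⊆ Y, #X ≤ h → #{e | tr₀ e = X} = (Fintype.card V - #Y).choose (h - #X))
    (hdeg : ∀ i, ∀ x ∈ Y, #{e | c e = i ∧ x ∈ tr₀ e} = r) (U : Finset V) (hU : Disjoint Y U) :
    ∃ tr : ε → Finset V, (∀ e, tr e ⊆ Y ∪ U) ∧ (∀ e, #(tr e) ≤ h) ∧
      (∀ X ⊆ Y ∪ U, #X ≤ h → #{e | tr e = X} = (Fintype.card V - #(Y ∪ U)).choose (h - #X)) ∧
      (∀ i, ∀ x ∈ Y ∪ U, #{e | c e = i ∧ x ∈ tr e} = r) ∧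
      ∀ e, tr e ∩ Y = tr₀ e := by
  induction U using Finset.induction_on with
  | empty =>
    simp only [union_empty]
    exact ⟨tr₀, hsub, hle, hfib, hdeg, fun e => inter_eq_left.2 (hsub e)⟩
  | insert v U hvU ih =>
    obtain ⟨tr, h1, h2, h3, h4, h5⟩ := ih (disjoint_insert_right.1 hU).2
    have hvY : v ∉ Y := (disjoint_insert_right.1 hU).1
    rw [union_insert]
    set W := Y ∪ U with hW
    have hv : v ∉ W := by simp [hW, hvY, hvU]
    have hvt (e : ε) : v ∉ tr e := fun h => hv (h1 e h)
    have hWn : #W < Fintype.card V := card_lt_univ_of_notMem hv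
    obtain ⟨D, hD1, hD2, hD3⟩ := exists_detachment_step hq c hc hv tr h1 h2 h3 h4
    refine ⟨fun e => if e ∈ D then insert v (tr e) else tr e, fun e => ?_, fun e => ?_,
      fun X hX hXh => ?_, fun i x hx => ?_, fun e => ?_⟩
    · dsimp only
      split_ifs
      · exact insert_subset_insert v (h1 e)
      · exact (h1 e).trans (subset_insert v W)
    · dsimp only
      split_ifs with he
      · rw [card_insert_of_notMem (hvt e)]
        exact hD3 e he
      · exact h2 e
    · rw [card_insert_of_notMem hv, ← Nat.sub_sub]
      by_cases hvX : v ∈ X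
      · have hX' : X.erase v ⊆ W := by
          intro x hx
          exact (mem_insert.1 (hX (mem_of_mem_erase hx))).resolve_left (ne_of_mem_erase hx)
        have hXc := card_erase_add_one hvX
        have := hD2 (X.erase v) hX' (by omega)
        rw [show h - #X = h - #(X.erase v) - 1 by omega, ← this]
        congr 1
        ext e
        simp only [mem_filter, mem_univ, true_and]
        constructor
        · intro he
          split_ifs at he with heD
          · exact ⟨heD, by rw [← he, erase_insert (hvt e)]⟩
          · exact absurd (he ▸ hvX) (hvt e)
        · rintro ⟨heD, he⟩
          rw [if_pos heD, he, insert_erase hvX]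
      · have hX' : X ⊆ W := fun x hx =>
          (mem_insert.1 (hX hx)).resolve_left fun h => hvX (h ▸ hx)
        have hset : ({e | (if e ∈ D then insert v (tr e) else tr e) = X} : Finset ε) =
            ({e | tr e = X} : Finset ε) \ {e ∈ D | tr e = X} := by
          ext e
          simp only [mem_filter, mem_univ, true_and, mem_sdiff, not_and]
          constructor
          · intro he
            split_ifs at he with heD
            · exact absurd (he ▸ mem_insert_self v (tr e)) hvX
            · exact ⟨he, fun h => absurd h heD⟩
          · rintro ⟨he, hn⟩
            rw [if_neg fun h => hn h he, he]
        rw [hset, card_sdiff_of_subset (filter_subset_filter _ (subset_univ D)),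
          h3 X hX' hXh]
        obtain ⟨N, hN⟩ : ∃ N, Fintype.card V - #W = N + 1 :=
          ⟨_, (Nat.sub_add_cancel (by omega)).symm⟩
        rcases hXh.lt_or_eq with hlt | heq
        · rw [hD2 X hX' hlt, hN]
          obtain ⟨j, hj⟩ : ∃ j, h - #X = j + 1 := ⟨_, (Nat.sub_add_cancel (by omega)).symm⟩
          rw [hj, Nat.add_sub_cancel, Nat.add_sub_cancel, Nat.choose_succ_succ']
          omega
        · have : ({e ∈ D | tr e = X} : Finset ε) = ∅ := by
            refine filter_eq_empty_iff.2 fun e he h => ?_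
            have := hD3 e he
            rw [h] at this
            omega
          simp [this, heq]
    · rcases mem_insert.1 hx with rfl | hxW
      · rw [← hD1 i]
        congr 1
        ext e
        by_cases he : e ∈ D <;> simp [he, hvt e]
      · rw [← h4 i x hxW]
        congr 1
        ext e
        have hne : x ≠ v := fun h => hv (h ▸ hxW)
        by_cases he : e ∈ D <;> simp [he, hne]
    · dsimp only
      split_ifs
      · rw [insert_inter_of_notMem hvY, h5]
      · exact h5 e

/-! ### Numerical estimates -/

theorem six_mul_cast_choose_three (N : ℕ) :
    (6 : ℝ) * N.choose 3 = N * (N - 1) * (N - 2) := by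
  rcases lt_or_ge N 3 with hN | hN
  · interval_cases N <;> norm_num [Nat.choose]
  · obtain ⟨a, rfl⟩ := Nat.exists_eq_add_of_le' hN
    have h1 := Nat.descFactorial_eq_factorial_mul_choose (a + 3) 3
    have h2 : ((a + 3).descFactorial 3 : ℝ) = (a + 3) * (a + 2) * (a + 1) := by
      simp [Nat.descFactorial]
      ring
    rw [h1] at h2
    push_cast [Nat.factorial] at h2 ⊢
    linarith

/-- The numerical condition for the greedy coloring. The leading terms give
`n ^ 3 ≤ 2 * (n - m) ^ 3`, that is, `n / m ≥ 1 / (1 - 2 ^ (-1 / 3)) = 4.84732210…`. -/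
theorem choose_three_le_two_mul_choose_three {m n : ℕ} (hm : 1 ≤ m)
    (hmn : (4.847323 : ℝ) * m ≤ n) : (n - 1).choose 3 ≤ 2 * (n - m).choose 3 := by
  have hm' : (1 : ℝ) ≤ m := by exact_mod_cast hm
  have hle : m ≤ n := by
    have : (m : ℝ) ≤ n := by linarith
    exact_mod_cast this
  have h1 := six_mul_cast_choose_three (n - 1)
  have h2 := six_mul_cast_choose_three (n - m)
  rw [Nat.cast_sub (hm.trans hle), Nat.cast_one] at h1
  rw [Nat.cast_sub hle] at h2
  have hlead : (n : ℝ) ^ 3 ≤ 2 * ((n : ℝ) - m) ^ 3 := by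
    have h3 : (3.847323 / 4.847323 : ℝ) * n ≤ n - m := by linarith
    have h4 : ((3.847323 / 4.847323 : ℝ) * n) ^ 3 ≤ ((n : ℝ) - m) ^ 3 :=
      pow_le_pow_left₀ (by positivity) h3 3
    have h5 : (0 : ℝ) ≤ (n : ℝ) ^ 3 := by positivity
    rw [mul_pow] at h4
    norm_num at h4
    linarith
  have hlow : (0 : ℝ) ≤ 6 * ((n : ℝ) ^ 2 - (n - m) ^ 2) + 4 * (n - m) - 11 * n + 6 := by
    nlinarith
  have : ((n - 1).choose 3 : ℝ) ≤ 2 * (n - m).choose 3 := by nlinarith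
  exact_mod_cast this

theorem three_mul_choose_two_mul_le {m n : ℕ} (hmn : 4 * m ≤ n) :
    3 * ((m - 1).choose 2 * (n - 3)) ≤ (n - 1).choose 3 := by
  rcases lt_or_ge m 3 with hm | hm
  · rw [Nat.choose_eq_zero_of_lt (by omega)]
    simp
  · obtain ⟨a, rfl⟩ := Nat.exists_eq_add_of_le' hm
    obtain ⟨b, rfl⟩ := Nat.exists_eq_add_of_le hmn
    have h1 := six_mul_cast_choose_three (4 * (a + 3) + b - 1)
    rw [Nat.cast_sub (by omega)] at h1
    have h2 := Nat.cast_choose_two ℝ (a + 3 - 1)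
    rw [Nat.cast_sub (by omega)] at h2
    have : (3 * (((a + 3 - 1).choose 2 : ℝ) * ((4 * (a + 3) + b - 3 : ℕ) : ℝ))) ≤
        (4 * (a + 3) + b - 1).choose 3 := by
      rw [Nat.cast_sub (by omega), h2]
      push_cast at h1 ⊢
      have ha : (0 : ℝ) ≤ a := by positivity
      have hb : (0 : ℝ) ≤ b := by positivity
      have h3 : 9 * (((a : ℝ) + 3 - 1) * (a + 3 - 1 - 1)) ≤
          (4 * ((a : ℝ) + 3) + b - 1) * (4 * (a + 3) + b - 1 - 1) := by
        nlinarith [mul_nonneg ha ha, mul_nonneg ha hb, mul_nonneg hb hb]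
      nlinarith [mul_le_mul_of_nonneg_right h3
        (show (0 : ℝ) ≤ 4 * ((a : ℝ) + 3) + b - 3 by linarith)]
    exact_mod_cast this

section

variable {V : Type*} [Fintype V] [DecidableEq V]

/-! ### Counting edges -/

theorem card_subtype_filter {α : Type*} (S : Finset α) [Fintype {e // e ∈ S}] (p : α → Prop)
    [DecidablePred p] : #{e : {e // e ∈ S} | p e.1} = #{e ∈ S | p e} := by
  rw [← card_map (Function.Embedding.subtype _)]
  congr 1
  ext e
  simp [and_comm]

theorem mem_completeEdges {α : Type*} {h : ℕ} {Y e : Finset α} :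
    e ∈ completeEdges h Y ↔ e ⊆ Y ∧ #e = h :=
  mem_powersetCard

/-- The edges of the complete `h`-uniform hypergraph on `V`, as a type. -/
abbrev Edge (V : Type*) [Fintype V] (h : ℕ) : Type _ :=
  {e : Finset V // e ∈ completeEdges h (univ : Finset V)}

/-- Edge sets are enumerated as finsets, which fixes one of the two competing instances
`Finset.Subtype.fintype` and `Subtype.fintype`. -/
instance (h : ℕ) : Fintype (Edge V h) := Finset.Subtype.fintype _

theorem card_completeEdges_inter_eq (h : ℕ) {X Y : Finset V} (hXY : X ⊆ Y) (hX : #X ≤ h) :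
    #{e : Edge V h | e.1 ∩ Y = X} =
      (Fintype.card V - #Y).choose (h - #X) := by
  rw [card_subtype_filter (completeEdges h univ) (fun e => e ∩ Y = X), ← card_compl,
    ← card_powersetCard]
  refine card_nbij' (fun e => e \ Y) (fun e => e ∪ X) ?_ ?_ ?_ ?_
  · intro e he
    simp only [coe_filter, mem_completeEdges, subset_univ, true_and, Set.mem_ofPred_eq] at he
    simp only [mem_coe, mem_powersetCard]
    refine ⟨fun x hx => mem_compl.2 (mem_sdiff.1 hx).2, ?_⟩
    have := card_sdiff_add_card_inter e Y
    rw [he.2] at this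
    omega
  · intro e he
    simp only [mem_coe, mem_powersetCard] at he
    have hd : Disjoint e Y := disjoint_left.2 fun x hx => mem_compl.1 (he.1 hx)
    simp only [coe_filter, mem_completeEdges, subset_univ, true_and, Set.mem_ofPred_eq]
    refine ⟨?_, ?_⟩
    · rw [card_union_of_disjoint (disjoint_of_subset_right hXY hd)]
      omega
    · rw [union_inter_distrib_right, disjoint_iff_inter_eq_empty.1 hd, empty_union,
        inter_eq_left.2 hXY]
  · intro e he
    simp only [coe_filter, mem_completeEdges, subset_univ, true_and, Set.mem_ofPred_eq] at he
    simp only [← he.2]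
    exact sdiff_union_inter e Y
  · intro e he
    simp only [mem_coe, mem_powersetCard] at he
    have hd : Disjoint e Y := disjoint_left.2 fun x hx => mem_compl.1 (he.1 hx)
    simp only [union_sdiff_distrib, sdiff_eq_empty_iff_subset.2 hXY, union_empty]
    exact sdiff_eq_self_of_disjoint hd

theorem card_completeEdges_superset (h : ℕ) {X : Finset V} (hX : #X ≤ h) :
    #{e : Edge V h | X ⊆ e.1} =
      (Fintype.card V - #X).choose (h - #X) := by
  rw [← card_completeEdges_inter_eq h (Subset.refl X) hX]
  simp only [inter_eq_right]

theorem card_completeEdges_mem {h : ℕ} (hh : 1 ≤ h) (v : V) :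
    #{e : Edge V h | v ∈ e.1} =
      (Fintype.card V - 1).choose (h - 1) := by
  simpa using card_completeEdges_superset h (X := {v}) (by simpa using hh)

theorem card_edges_three_le_card_inter {Y : Finset V} {v : V} (hv : v ∈ Y) :
    #{e : Edge V 4 | 3 ≤ #(e.1 ∩ Y) ∧ v ∈ e.1} ≤
      (#Y - 1).choose 2 * (Fintype.card V - 3) := by
  -- Such an edge contains `v`, two further vertices of `Y`, and one of `card V - 3` others.
  rw [← card_erase_of_mem hv, ← card_powersetCard]
  refine le_trans (card_le_card ?_) (card_biUnion_le_card_mul (powersetCard 2 (Y.erase v))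
    (fun P => {e : Edge V 4 | insert v P ⊆ e.1}) _ ?_)
  · intro e he
    simp only [mem_filter, mem_univ, true_and] at he
    have hve : v ∈ e.1 ∩ Y := mem_inter.2 ⟨he.2, hv⟩
    obtain ⟨P, hP, hPc⟩ := exists_subset_card_eq (s := (e.1 ∩ Y).erase v) (n := 2)
      (by rw [card_erase_of_mem hve]; omega)
    simp only [mem_biUnion, mem_filter, mem_univ, true_and]
    refine ⟨P, mem_powersetCard.2 ⟨hP.trans (erase_subset_erase v inter_subset_right), hPc⟩, ?_⟩
    exact insert_subset he.2 ((hP.trans (erase_subset v _)).trans inter_subset_left)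
  · intro P hP
    obtain ⟨hP, hPc⟩ := mem_powersetCard.1 hP
    have hc : #(insert v P) = 3 := by
      rw [card_insert_of_notMem fun h => notMem_erase v Y (hP h), hPc]
    rw [card_completeEdges_superset 4 (by omega), hc]
    simp

/-- The edges through `v` that meet `Y` only in `v` number `(card V - #Y).choose 3`. -/
theorem card_edges_two_le_card_inter_add {Y : Finset V} {v : V} (hv : v ∈ Y) :
    #{e : Edge V 4 | 2 ≤ #(e.1 ∩ Y) ∧ v ∈ e.1} +
      (Fintype.card V - #Y).choose 3 = (Fintype.card V - 1).choose 3 := by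
  have h1 := card_completeEdges_mem (h := 4) (by norm_num) v
  have h2 := card_completeEdges_inter_eq 4 (singleton_subset_iff.2 hv) (by simp)
  rw [card_singleton] at h2
  rw [← h1, ← h2, ← card_union_of_disjoint]
  · congr 1
    ext e
    simp only [mem_union, mem_filter, mem_univ, true_and]
    constructor
    · rintro (h | h)
      · exact h.2
      · exact (mem_inter.1 (h ▸ mem_singleton_self v)).1
    · intro hve
      have hvY : v ∈ e.1 ∩ Y := mem_inter.2 ⟨hve, hv⟩
      by_cases h : 2 ≤ #(e.1 ∩ Y)
      · exact Or.inl ⟨h, hve⟩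
      · refine Or.inr (eq_singleton_iff_unique_mem.2 ⟨hvY, fun x hx => ?_⟩)
        exact card_le_one.1 (by omega) x hx v hvY
  · refine disjoint_left.2 fun e he he' => ?_
    simp only [mem_filter, mem_univ, true_and] at he he'
    rw [he', card_singleton] at he
    omega

/-! ### Coloring tools -/

/-- If no color were free at all vertices of `Z`, every color would contribute at least `r` to the
sum of the degrees over `Z`. -/
theorem exists_color_forall_card_lt {ε : Type*} [DecidableEq ε] {l r : ℕ} (inc : ε → Finset V)
    (c : ε → Fin l) (S : Finset ε) (Z : Finset V)
    (h : ∑ v ∈ Z, #{e ∈ S | v ∈ inc e} < l * r) :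
    ∃ i, ∀ v ∈ Z, #{e ∈ S | c e = i ∧ v ∈ inc e} < r := by
  by_contra! hcon
  refine h.not_ge ?_
  calc l * r = ∑ _i : Fin l, r := by simp
    _ ≤ ∑ i : Fin l, ∑ v ∈ Z, #{e ∈ S | c e = i ∧ v ∈ inc e} := by
      refine sum_le_sum fun i _ => ?_
      obtain ⟨v, hv, hvr⟩ := hcon i
      exact hvr.trans (single_le_sum (f := fun v => #{e ∈ S | c e = i ∧ v ∈ inc e})
        (fun _ _ => Nat.zero_le _) hv)
    _ = ∑ v ∈ Z, #{e ∈ S | v ∈ inc e} := by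
      rw [sum_comm]
      refine sum_congr rfl fun v _ => ?_
      rw [card_eq_sum_card_fiberwise (f := c) (t := univ) fun _ _ => mem_coe.2 (mem_univ _)]
      refine sum_congr rfl fun i _ => ?_
      rw [filter_filter]
      simp only [and_comm]

/-- Greedy coloring of the edges in `U` on top of a coloring of `S`, keeping all color degrees on `Y`
at most `r`. An edge of `U` that is not yet colored is missing from the degrees of its vertices, so
the bound `#(inc e ∩ Y) * B ≤ l * r` need not be strict. -/
theorem exists_greedy_coloring {ε : Type*} [DecidableEq ε] {l r B : ℕ}
    (inc : ε → Finset V) (Y : Finset V) (S T U : Finset ε) (hSU : Disjoint S U)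
    (hT : S ∪ U ⊆ T) (hB : ∀ v ∈ Y, #{e ∈ T | v ∈ inc e} ≤ B)
    (hne : ∀ e ∈ U, (inc e ∩ Y).Nonempty) (hU : ∀ e ∈ U, #(inc e ∩ Y) * B ≤ l * r)
    (c : ε → Fin l) (hc : ∀ i, ∀ v ∈ Y, #{e ∈ S | c e = i ∧ v ∈ inc e} ≤ r) :
    ∃ c' : ε → Fin l, (∀ e ∈ S, c' e = c e) ∧
      ∀ i, ∀ v ∈ Y, #{e ∈ S ∪ U | c' e = i ∧ v ∈ inc e} ≤ r := by
  induction U using Finset.induction_on with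
  | empty => exact ⟨c, fun _ _ => rfl, by simpa using hc⟩
  | insert a U haU ih =>
    obtain ⟨haS, hSU'⟩ := disjoint_insert_right.1 hSU
    rw [union_insert] at hT ⊢
    obtain ⟨c', hc'S, hc'⟩ := ih hSU' ((subset_insert _ _).trans hT)
      (fun e he => hne e (mem_insert_of_mem he)) fun e he => hU e (mem_insert_of_mem he)
    have ha : a ∉ S ∪ U := by simp [haS, haU]
    have hlt : ∑ v ∈ inc a ∩ Y, #{e ∈ S ∪ U | v ∈ inc e} < l * r := by
      refine lt_of_lt_of_le ?_ (hU a (mem_insert_self a U))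
      rw [← smul_eq_mul, ← sum_const]
      refine sum_lt_sum_of_nonempty (hne a (mem_insert_self a U)) fun v hv => ?_
      refine lt_of_lt_of_le (card_lt_card ?_) (hB v (mem_inter.1 hv).2)
      refine (ssubset_iff_of_subset
        (filter_subset_filter _ ((subset_insert _ _).trans hT))).2 ⟨a, ?_, ?_⟩
      · exact mem_filter.2 ⟨hT (mem_insert_self _ _), (mem_inter.1 hv).1⟩
      · exact fun h => ha (mem_filter.1 h).1
    obtain ⟨i₀, hi₀⟩ := exists_color_forall_card_lt inc c' (S ∪ U) (inc a ∩ Y) hlt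
    refine ⟨Function.update c' a i₀, fun e he => ?_, fun i v hv => ?_⟩
    · rw [Function.update_of_ne (ne_of_mem_of_not_mem he haS), hc'S e he]
    · have hold : #{e ∈ S ∪ U | Function.update c' a i₀ e = i ∧ v ∈ inc e} =
          #{e ∈ S ∪ U | c' e = i ∧ v ∈ inc e} := by
        congr 1
        refine filter_congr fun e he => ?_
        rw [Function.update_of_ne (ne_of_mem_of_not_mem he ha)]
      rw [filter_insert]
      split_ifs with hia
      · rw [Function.update_self] at hia
        have := card_insert_le a
          {e ∈ S ∪ U | Function.update c' a i₀ e = i ∧ v ∈ inc e}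
        have := hi₀ v (mem_inter.2 ⟨hia.2, hv⟩)
        rw [hia.1] at this
        omega
      · exact hold.le.trans (hc' i v hv)

theorem exists_coloring_card_eq {ε : Type*} [DecidableEq ε] {l : ℕ} (F : Finset ε)
    (q : Fin l → ℕ) (hq : ∑ i, q i = #F) :
    ∃ d : F → Fin l, ∀ i, #{e | d e = i} = q i := by
  have : Fintype.card F = Fintype.card (Σ i, Fin (q i)) := by simp [hq]
  let φ := Fintype.equivOfCardEq this
  refine ⟨fun e => (φ e).1, fun i => ?_⟩
  rw [← Fintype.card_fin (q i), ← Fintype.card_subtype]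
  refine Fintype.card_congr ?_
  exact (φ.subtypeEquiv (q := fun s => s.1 = i) fun _ => Iff.rfl).trans
    (Equiv.sigmaSubtype i)

/-- Any prescribed numbers of edges of each color can be realized on the fibers of `key` over `P`,
without touching the other fibers. -/
theorem exists_recoloring_card_eq {ε κ : Type*} [Fintype ε] [DecidableEq ε] [DecidableEq κ]
    {l : ℕ} (key : ε → κ) (P : Finset κ) (q : κ → Fin l → ℕ)
    (hq : ∀ k ∈ P, ∑ i, q k i = #{e | key e = k}) (c : ε → Fin l) :
    ∃ c' : ε → Fin l, (∀ e, key e ∉ P → c' e = c e) ∧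
      ∀ k ∈ P, ∀ i, #{e | key e = k ∧ c' e = i} = q k i := by
  have h (k : κ) : ∃ d : ε → Fin l, k ∈ P → ∀ i, #{e | key e = k ∧ d e = i} = q k i := by
    by_cases hk : k ∈ P
    · obtain ⟨d, hd⟩ := exists_coloring_card_eq _ (q k) (hq k hk)
      refine ⟨fun e => if he : e ∈ ({e | key e = k} : Finset ε) then d ⟨e, he⟩ else c e,
        fun _ i => ?_⟩
      rw [← hd i, ← card_map (Function.Embedding.subtype _)]
      congr 1
      ext e
      simp only [mem_filter, mem_univ, true_and, mem_map, Function.Embedding.coe_subtype,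
        Subtype.exists, exists_and_right, exists_eq_right]
      constructor
      · rintro ⟨h1, h2⟩
        exact ⟨h1, by simpa [h1] using h2⟩
      · rintro ⟨h1, h2⟩
        exact ⟨h1, by simpa [h1] using h2⟩
    · exact ⟨c, fun h => absurd h hk⟩
  choose d hd using h
  refine ⟨fun e => if key e ∈ P then d (key e) e else c e, fun e he => if_neg he,
    fun k hk i => ?_⟩
  rw [← hd k hk i]
  congr 1
  refine filter_congr fun e _ => and_congr_right fun he => ?_
  subst he
  simp [hk]

/-! ### Coloring all edges with the vertices outside `Y` identified -/

/-- Greedy extension to all edges with at least two vertices in `Y`. The edges with three vertices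
in `Y` come before those with two, since then fewer edges compete at each vertex. -/
theorem exists_greedy_coloring_two_le {Y : Finset V} {l r : ℕ}
    (hl : l * r = (Fintype.card V - 1).choose 3) (hY : 4 * #Y ≤ Fintype.card V)
    (hch : (Fintype.card V - 1).choose 3 ≤ 2 * (Fintype.card V - #Y).choose 3)
    (c : Edge V 4 → Fin l)
    (hc : ∀ i, ∀ v ∈ Y, #{e | e.1 ⊆ Y ∧ c e = i ∧ v ∈ e.1} ≤ r) :
    ∃ c' : Edge V 4 → Fin l, (∀ e, e.1 ⊆ Y → c' e = c e) ∧
      ∀ i, ∀ v ∈ Y, #{e | 2 ≤ #(e.1 ∩ Y) ∧ c' e = i ∧ v ∈ e.1} ≤ r := by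
  have h4 (e : Edge V 4) : #e.1 = 4 :=
    (mem_completeEdges.1 e.2).2
  -- `T 4` is the set of the edges inside `Y`.
  let T (j : ℕ) : Finset (Edge V 4) := {e | j ≤ #(e.1 ∩ Y)}
  have hT4 (e) : e ∈ T 4 ↔ e.1 ⊆ Y := by
    simp only [T, mem_filter, mem_univ, true_and, ← inter_eq_left]
    constructor
    · exact fun h => eq_of_subset_of_card_le inter_subset_left (by rwa [h4])
    · exact fun h => by rw [h, h4]
  have hanti {i j : ℕ} (hij : i ≤ j) : T j ⊆ T i := by
    intro e he
    simp only [T, mem_filter, mem_univ, true_and] at he ⊢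
    omega
  have hcard {j : ℕ} {e} (he : e ∈ T j \ T (j + 1)) : #(e.1 ∩ Y) = j := by
    simp only [T, mem_sdiff, mem_filter, mem_univ, true_and] at he
    omega
  have step {j B : ℕ} (hj : 0 < j) (hB : ∀ v ∈ Y, #{e ∈ T j | v ∈ e.1} ≤ B)
      (hjB : j * B ≤ l * r) (c : Edge V 4 → Fin l)
      (hc : ∀ i, ∀ v ∈ Y, #{e ∈ T (j + 1) | c e = i ∧ v ∈ e.1} ≤ r) :
      ∃ c' : Edge V 4 → Fin l, (∀ e ∈ T (j + 1), c' e = c e) ∧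
        ∀ i, ∀ v ∈ Y, #{e ∈ T j | c' e = i ∧ v ∈ e.1} ≤ r := by
    have hu : T (j + 1) ∪ T j \ T (j + 1) = T j := union_sdiff_of_subset (hanti j.le_succ)
    have := exists_greedy_coloring Subtype.val Y (T (j + 1)) (T j) (T j \ T (j + 1))
      disjoint_sdiff hu.subset hB (fun e he => card_pos.1 (by rwa [hcard he]))
      (fun e he => by rwa [hcard he]) c hc
    rwa [hu] at this
  obtain ⟨c₃, h3, h3'⟩ := step (j := 3) (B := (#Y - 1).choose 2 * (Fintype.card V - 3))
    (by norm_num) (fun v hv => by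
      rw [filter_filter]
      exact card_edges_three_le_card_inter hv)
    (by rw [hl]; exact three_mul_choose_two_mul_le hY) c (fun i v hv => by
      simpa only [hT4, ← filter_filter, filter_mem_eq_inter, univ_inter,
        show ({e | e.1 ⊆ Y} : Finset (Edge V 4)) = T 4 by
          ext e; simp [hT4]] using hc i v hv)
  obtain ⟨c₂, h2, h2'⟩ := step (j := 2)
    (B := (Fintype.card V - 1).choose 3 - (Fintype.card V - #Y).choose 3) (by norm_num)
    (fun v hv => by
      rw [filter_filter]
      exact Nat.le_sub_of_add_le (card_edges_two_le_card_inter_add hv).le)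
    (by omega) c₃ h3'
  refine ⟨c₂, fun e he => ?_, fun i v hv => ?_⟩
  · have he4 := (hT4 e).2 he
    rw [h2 e (hanti (by norm_num) he4), h3 e he4]
  · have := h2' i v hv
    rwa [filter_filter] at this

/-- The edges with exactly one vertex in `Y` and those with none complete the coloring: the former
bring every color degree on `Y` up to `r`, the latter every color class up to `q` edges. -/
theorem exists_regular_coloring {Y : Finset V} {l r q : ℕ}
    (hl : l * r = (Fintype.card V - 1).choose 3) (hq : 4 * q = r * Fintype.card V)
    (hY : 4 * #Y ≤ Fintype.card V) (hn : 0 < Fintype.card V)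
    (c : Edge V 4 → Fin l)
    (hc : ∀ i, ∀ v ∈ Y, #{e | 2 ≤ #(e.1 ∩ Y) ∧ c e = i ∧ v ∈ e.1} ≤ r) :
    ∃ c' : Edge V 4 → Fin l, (∀ e, e.1 ⊆ Y → c' e = c e) ∧
      (∀ i, #{e | c' e = i} = q) ∧ ∀ i, ∀ v ∈ Y, #{e | c' e = i ∧ v ∈ e.1} = r := by
  have h4 (e : Edge V 4) : #e.1 = 4 :=
    (mem_completeEdges.1 e.2).2
  have hself {e : Edge V 4} (he : e.1 ⊆ Y) :
      #(e.1 ∩ Y) = 4 := by rw [inter_eq_left.2 he, h4]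
  -- The edges with one vertex in `Y` supply the missing degrees.
  obtain ⟨c₁, h1, h1'⟩ := exists_recoloring_card_eq (ε := Edge V 4)
    (fun e => e.1 ∩ Y) (Y.image fun v => {v})
    (fun X i => ∑ v ∈ X, (r - #{e | 2 ≤ #(e.1 ∩ Y) ∧ c e = i ∧ v ∈ e.1}))
    (by
      intro X hX
      obtain ⟨v, hv, rfl⟩ := mem_image.1 hX
      simp only [sum_singleton]
      rw [card_completeEdges_inter_eq 4 (singleton_subset_iff.2 hv) (by simp), card_singleton]
      have h2 := card_edges_two_le_card_inter_add hv
      rw [card_eq_sum_card_fiberwise (f := c) (t := univ) fun _ _ => mem_coe.2 (mem_univ _),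
        ← hl] at h2
      have h3 : ∑ i : Fin l, ((r - #{e | 2 ≤ #(e.1 ∩ Y) ∧ c e = i ∧ v ∈ e.1}) +
          #{e | 2 ≤ #(e.1 ∩ Y) ∧ c e = i ∧ v ∈ e.1}) = l * r := by
        rw [sum_congr rfl fun i _ => Nat.sub_add_cancel (hc i v hv)]
        simp
      rw [sum_add_distrib] at h3
      have h4 : ∑ i : Fin l, #{e | 2 ≤ #(e.1 ∩ Y) ∧ c e = i ∧ v ∈ e.1} =
          ∑ i : Fin l, #{e ∈ ({e | 2 ≤ #(e.1 ∩ Y) ∧ v ∈ e.1} : Finset (Edge V 4)) | c e = i} := by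
        refine sum_congr rfl fun i _ => ?_
        rw [filter_filter]
        congr 1
        exact filter_congr fun e _ => by tauto
      simp only [Nat.add_one_sub_one] at *
      omega) c
  have hdeg₁ (i) (v) (hv : v ∈ Y) : #{e | c₁ e = i ∧ v ∈ e.1} = r := by
    have hsplit : ({e | c₁ e = i ∧ v ∈ e.1} : Finset (Edge V 4)) =
        ({e | 2 ≤ #(e.1 ∩ Y) ∧ c e = i ∧ v ∈ e.1} : Finset (Edge V 4)) ∪
          ({e | e.1 ∩ Y = {v} ∧ c₁ e = i} : Finset (Edge V 4)) := by
      ext e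
      simp only [mem_filter, mem_univ, true_and, mem_union]
      by_cases h : 2 ≤ #(e.1 ∩ Y)
      · have hne : e.1 ∩ Y ≠ {v} := fun he => by
          rw [he, card_singleton] at h
          omega
        rw [h1 e fun he => ?_]
        · simp [h, hne]
        · obtain ⟨w, -, hw⟩ := mem_image.1 he
          rw [← hw, card_singleton] at h
          omega
      · simp only [h, false_and, false_or]
        constructor
        · rintro ⟨hi, hve⟩
          have hvY : v ∈ e.1 ∩ Y := mem_inter.2 ⟨hve, hv⟩
          refine ⟨eq_singleton_iff_unique_mem.2 ⟨hvY, fun x hx => ?_⟩, hi⟩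
          exact card_le_one.1 (by omega) x hx v hvY
        · rintro ⟨he, hi⟩
          exact ⟨hi, (mem_inter.1 (he ▸ mem_singleton_self v)).1⟩
    rw [hsplit, card_union_of_disjoint, h1' _ (mem_image_of_mem _ hv), sum_singleton]
    · have := hc i v hv
      omega
    · refine disjoint_left.2 fun e he he' => ?_
      simp only [mem_filter, mem_univ, true_and] at he he'
      rw [he'.1, card_singleton] at he
      omega
  -- A color class has at most `r * #Y ≤ q` edges that meet `Y`.
  have hmeet (i) : #{e | (e.1 ∩ Y).Nonempty ∧ c₁ e = i} ≤ q := by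
    have h2 : #{e | (e.1 ∩ Y).Nonempty ∧ c₁ e = i} ≤ #Y * r := by
      refine le_trans (card_le_card ?_) (card_biUnion_le_card_mul Y
        (fun v => {e | c₁ e = i ∧ v ∈ e.1}) r fun v hv => (hdeg₁ i v hv).le)
      intro e he
      simp only [mem_filter, mem_univ, true_and] at he
      obtain ⟨⟨v, hv⟩, hi⟩ := he
      exact mem_biUnion.2 ⟨v, (mem_inter.1 hv).2,
        mem_filter.2 ⟨mem_univ _, hi, (mem_inter.1 hv).1⟩⟩
    nlinarith
  obtain ⟨c₀, h0, h0'⟩ := exists_recoloring_card_eq (ε := Edge V 4)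
    (fun e => e.1 ∩ Y) {∅} (fun _ i => q - #{e | (e.1 ∩ Y).Nonempty ∧ c₁ e = i})
    (by
      intro X hX
      obtain rfl := mem_singleton.1 hX
      have h2 : ∑ i : Fin l, ((q - #{e | (e.1 ∩ Y).Nonempty ∧ c₁ e = i}) +
          #{e | (e.1 ∩ Y).Nonempty ∧ c₁ e = i}) = l * q := by
        rw [sum_congr rfl fun i _ => Nat.sub_add_cancel (hmeet i)]
        simp
      rw [sum_add_distrib] at h2
      have h3 : ∑ i : Fin l, #{e | (e.1 ∩ Y).Nonempty ∧ c₁ e = i} =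
          #({e | (e.1 ∩ Y).Nonempty} : Finset (Edge V 4)) := by
        rw [card_eq_sum_card_fiberwise (f := c₁) (t := univ) fun _ _ => mem_coe.2 (mem_univ _)]
        simp only [filter_filter]
      have h5 : #({e | (e.1 ∩ Y).Nonempty} : Finset (Edge V 4)) +
          #({e | e.1 ∩ Y = ∅} : Finset (Edge V 4)) = l * q := by
        simp only [← not_nonempty_iff_eq_empty]
        rw [card_filter_add_card_filter_not, card_univ, Fintype.card_coe, completeEdges,
          card_powersetCard, card_univ]
        obtain ⟨a, ha⟩ : ∃ a, Fintype.card V = a + 1 := ⟨_, (Nat.sub_add_cancel hn).symm⟩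
        have h6 := Nat.add_one_mul_choose_eq a 3
        rw [ha, Nat.add_sub_cancel] at hl
        rw [ha] at hq ⊢
        rw [← hl] at h6
        nlinarith
      omega) c₁
  have hne {e : Edge V 4} (he : (e.1 ∩ Y).Nonempty) :
      c₀ e = c₁ e :=
    h0 e (by simpa using he.ne_empty)
  refine ⟨c₀, fun e he => ?_, fun i => ?_, fun i v hv => ?_⟩
  · have := hself he
    rw [hne (card_pos.1 (by omega)), h1 e fun h => ?_]
    obtain ⟨w, -, hw⟩ := mem_image.1 h
    rw [← hw, card_singleton] at this
    omega
  · have hsplit : ({e | c₀ e = i} : Finset (Edge V 4)) =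
        ({e | (e.1 ∩ Y).Nonempty ∧ c₁ e = i} : Finset (Edge V 4)) ∪
          ({e | e.1 ∩ Y = ∅ ∧ c₀ e = i} : Finset (Edge V 4)) := by
      ext e
      simp only [mem_filter, mem_univ, true_and, mem_union]
      rcases (e.1 ∩ Y).eq_empty_or_nonempty with h | h
      · simp [h]
      · simp [h, h.ne_empty, hne h]
    rw [hsplit, card_union_of_disjoint, h0' _ (mem_singleton_self _)]
    · have := hmeet i
      omega
    · refine disjoint_left.2 fun e he he' => ?_
      simp only [mem_filter, mem_univ, true_and] at he he'
      exact he.1.ne_empty he'.1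
  · rw [← hdeg₁ i v hv]
    congr 1
    refine filter_congr fun e _ => and_congr_left fun hve => ?_
    rw [hne ⟨v, mem_inter.2 ⟨hve, hv⟩⟩]

/-! ### Factorizations -/

theorem EdgeColoring.degree_eq_card {V : Type*} [DecidableEq V] {S : Finset (Finset V)} {k : ℕ}
    [Fintype {e // e ∈ S}] (f : EdgeColoring S k) (i : Fin k) (v : V) :
    f.degree i v = #{e | f e = i ∧ v ∈ e.1} := by
  unfold EdgeColoring.degree
  congr!

/-- A coloring with color classes of the right size that is regular on `Y` can be rearranged outside
`Y` into a factorization: after all vertices outside `Y` have been detached, every edge has become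
a definite `h`-set again, and the edges inside `Y` are unchanged. -/
theorem exists_isFactorization_of_regular_on {Y : Finset V} {h l r q : ℕ}
    (hq : h * q = r * Fintype.card V)
    (c : Edge V h → Fin l)
    (hc : ∀ i, #{e | c e = i} = q) (hdeg : ∀ i, ∀ v ∈ Y, #{e | c e = i ∧ v ∈ e.1} = r) :
    ∃ g : EdgeColoring (completeEdges h (univ : Finset V)) l, g.IsFactorization h r ∧
      ∀ e, e.1 ⊆ Y → g e = c e := by
  have hcard (e : Edge V h) : #e.1 = h :=
    (mem_completeEdges.1 e.2).2
  obtain ⟨tr, -, h2, h3, h4, h5⟩ := exists_detachment hq c hc (Y := Y) (fun e => e.1 ∩ Y)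
    (fun e => inter_subset_right) (fun e => (card_le_card inter_subset_left).trans (hcard e).le)
    (fun X hX hXh => card_completeEdges_inter_eq h hX hXh)
    (fun i v hv => by simpa [hv] using hdeg i v hv) Yᶜ disjoint_compl_right
  simp only [union_compl, subset_univ, forall_const, card_univ, Nat.sub_self, mem_univ] at h3 h4
  have htr (e) : #(tr e) = h := by
    by_contra hne
    have h6 := h3 (tr e) (h2 e)
    have h7 := h2 e
    rw [Nat.choose_eq_zero_of_lt (by omega), card_eq_zero] at h6
    exact notMem_empty e (h6 ▸ mem_filter.2 ⟨mem_univ e, rfl⟩)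
  -- Every `h`-set is the detached form of exactly one edge, as `Nat.choose 0 0 = 1`.
  have hbij : Function.Bijective fun e : Edge V h =>
      (⟨tr e, mem_completeEdges.2 ⟨subset_univ _, htr e⟩⟩ :
        Edge V h) := by
    refine (Function.bijective_iff_existsUnique _).2 fun X => ?_
    have h6 := h3 X.1 (hcard X).le
    rw [hcard X, Nat.sub_self, Nat.choose_self] at h6
    obtain ⟨e, he⟩ := card_eq_one.1 h6
    have hmem (e') : tr e' = X.1 ↔ e' = e := by
      rw [← mem_singleton (a := e), ← he]
      simp
    exact ⟨e, Subtype.ext ((hmem e).2 rfl), fun e' he' => (hmem e').1 (congrArg Subtype.val he')⟩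
  let φ := Equiv.ofBijective _ hbij
  refine ⟨fun X => c (φ.symm X), fun i v => ?_, fun e he => ?_⟩
  · rw [EdgeColoring.degree_eq_card, ← h4 i v]
    refine card_equiv φ.symm fun X => ?_
    obtain ⟨e, rfl⟩ := φ.surjective X
    simp [φ]
  · obtain ⟨e', rfl⟩ := φ.surjective e
    simp only [Equiv.symm_apply_apply]
    congr 1
    have h6 := h5 e'
    have h7 : tr e' ⊆ Y := he
    rw [inter_eq_left.2 h7] at h6
    refine Subtype.ext ?_
    refine (eq_of_subset_of_card_le (s := tr e') (h6 ▸ inter_subset_left) ?_).symm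
    rw [hcard, htr]

theorem EdgeColoring.IsFactorization.mul_eq_choose {h l r : ℕ} (hh : 1 ≤ h)
    {g : EdgeColoring (completeEdges h (univ : Finset V)) l} (hg : g.IsFactorization h r) (v : V) :
    l * r = (Fintype.card V - 1).choose (h - 1) := by
  rw [← card_completeEdges_mem hh v,
    card_eq_sum_card_fiberwise (f := g) (t := univ) fun _ _ => mem_coe.2 (mem_univ _)]
  rw [sum_congr rfl (g := fun _ => r) fun i _ => ?_]
  · simp
  · rw [← hg i v, EdgeColoring.degree_eq_card, filter_filter]
    simp only [and_comm]

theorem EdgeColoring.IsFactorization.dvd {h l r : ℕ}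
    {g : EdgeColoring (completeEdges h (univ : Finset V)) l} (hg : g.IsFactorization h r)
    (i : Fin l) : h ∣ r * Fintype.card V := by
  refine ⟨#{e | g e = i}, ?_⟩
  have h1 := sum_card_bipartiteAbove_eq_sum_card_bipartiteBelow
    (s := ({e | g e = i} : Finset (Edge V h)))
    (t := (univ : Finset V)) (fun e x => x ∈ e.1)
  have h2 (e : Edge V h) : #(bipartiteAbove (fun (e : Edge V h) x => x ∈ e.1) univ e) = h :=
    (congrArg card (by ext; simp [bipartiteAbove])).trans (mem_completeEdges.1 e.2).2
  have h3 (v : V) : #(bipartiteBelow (fun (e : Edge V h) x => x ∈ e.1)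
      ({e | g e = i} : Finset (Edge V h)) v) = r := by
    rw [← hg i v, EdgeColoring.degree_eq_card, bipartiteBelow, filter_filter]
  rw [sum_congr rfl fun e _ => h2 e, sum_congr rfl fun v _ => h3 v, sum_const, sum_const,
    card_univ, smul_eq_mul, smul_eq_mul] at h1
  linarith

end

theorem theorem4p1 {V : Type*} [Fintype V] [DecidableEq V] (Y : Finset V) (m n r : ℕ)
    (hm : 0 < m) (hr : 0 < r) (hV : Fintype.card V = n) (hY : Y.card = m)
    (hmn : (4.847323 : ℝ) * (m : ℝ) ≤ (n : ℝ))
    (k : ℕ) (f : EdgeColoring (completeEdges 4 Y) k) (hf : f.IsPartialFactorization 4 r) :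
    (∃ (l : ℕ) (g : EdgeColoring (completeEdges 4 (Finset.univ : Finset V)) l),
        g.IsFactorization 4 r ∧ g.Extends f) ↔
      4 ∣ r * n ∧ r ∣ (n - 1).choose 3 := by
  subst hV hY
  have hm' : (1 : ℝ) ≤ #Y := by exact_mod_cast hm
  have h4 : 4 * #Y < Fintype.card V := by
    have : (4 : ℝ) * #Y < Fintype.card V := by linarith
    exact_mod_cast this
  have hpos : 0 < (Fintype.card V - 1).choose 3 := Nat.choose_pos (by omega)
  obtain ⟨v, hv⟩ := card_pos.1 hm
  constructor
  · rintro ⟨l, g, hg, -⟩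
    have hl : l * r = (Fintype.card V - 1).choose 3 := hg.mul_eq_choose (by norm_num) v
    have hl0 : 0 < l := Nat.pos_of_mul_pos_right (hl ▸ hpos)
    exact ⟨hg.dvd ⟨0, hl0⟩, hl ▸ dvd_mul_left r l⟩
  · rintro ⟨⟨q, hq⟩, ⟨l, hl⟩⟩
    rw [mul_comm] at hl
    have hkl : k ≤ l := Nat.le_of_mul_le_mul_right (hf.colors_le.trans hl.le) hr
    have hl0 : 0 < l := Nat.pos_of_mul_pos_right (hl ▸ hpos)
    -- The values of `c` on edges that are not inside `Y` are irrelevant.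
    let c : Edge V 4 → Fin l := fun e =>
      if he : e.1 ∈ completeEdges 4 Y then Fin.castLE hkl (f ⟨e.1, he⟩) else ⟨0, hl0⟩
    have hmem (e : Edge V 4) (he : e.1 ⊆ Y) :
        e.1 ∈ completeEdges 4 Y :=
      mem_completeEdges.2 ⟨he, (mem_completeEdges.1 e.2).2⟩
    have hc (i : Fin l) (v : V) : #{e | e.1 ⊆ Y ∧ c e = i ∧ v ∈ e.1} ≤ r := by
      by_cases hi : (i : ℕ) < k
      · refine le_trans ?_ (hf.degree_le ⟨i, hi⟩ v)
        rw [EdgeColoring.degree_eq_card]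
        refine card_le_card_of_surjOn
          (fun e => ⟨e.1, mem_completeEdges.2 ⟨subset_univ _, (mem_completeEdges.1 e.2).2⟩⟩) ?_
        intro e he
        simp only [coe_filter, mem_univ, true_and, Set.mem_ofPred_eq] at he
        obtain ⟨heY, hci, hve⟩ := he
        refine ⟨⟨e.1, hmem e heY⟩, ?_, rfl⟩
        simp only [coe_filter, mem_univ, true_and, Set.mem_ofPred_eq]
        refine ⟨?_, hve⟩
        have hci' := congrArg Fin.val hci
        simp only [c, hmem e heY, dite_true, Fin.val_castLE] at hci'
        exact Fin.ext hci'
      · rw [card_eq_zero.2]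
        · exact Nat.zero_le r
        · refine filter_eq_empty_iff.2 fun e _ ⟨heY, hci, _⟩ => hi ?_
          rw [← hci]
          simp [c, hmem e heY]
    obtain ⟨c₂, h2, h2'⟩ := exists_greedy_coloring_two_le hl.symm h4.le
      (choose_three_le_two_mul_choose_three hm hmn) c fun i v _ => hc i v
    obtain ⟨c₀, h0, h0', h0''⟩ := exists_regular_coloring hl.symm hq.symm h4.le (by omega) c₂ h2'
    obtain ⟨g, hg, hgc⟩ := exists_isFactorization_of_regular_on hq.symm c₀ h0' h0''
    refine ⟨l, g, hg, fun e => ?_⟩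
    obtain ⟨heY, hec⟩ := mem_completeEdges.1 e.2
    have heu : e.1 ∈ completeEdges 4 (univ : Finset V) :=
      mem_completeEdges.2 ⟨subset_univ _, hec⟩
    refine ⟨heu, ?_⟩
    rw [hgc ⟨e.1, heu⟩ heY, h0 ⟨e.1, heu⟩ heY, h2 ⟨e.1, heu⟩ heY]
    simp [c]
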